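/- Let $\alpha,\beta>0$, $V(x)=\frac{\alpha}{|x|^{12}}-\frac{\beta}{|x|^{6}}$ and $\mathbb{R}_+=[0,\infty)$. On $L^2(\mathbb{R}_+)$ (complex valued functions, inner product conjugate linear in the first argument) consider the sesquilinear form $$q_{\alpha,\beta}[\varphi,h]=\int_{\mathbb{R}_+}\overline{\varphi'}\,h'\,dx+\alpha\int_{\mathbb{R}_+}\frac{\overline{\varphi}\,h}{|x|^{12}}\,dx-\beta\int_{\mathbb{R}_+}\frac{\overline{\varphi}\,h}{|x|^{6}}\,dx$$ with form domain $\mathcal{D}_q=\{\varphi\in H^1(\mathbb{R}_+):\int_{\mathbb{R}_+}V|\varphi|^2\,dx<\infty\}$, and let $H_{\alpha,\beta}=-\frac{d^2}{dx^2}+V$ be the associated operator, whose domain is $$D(H_{\alpha,\beta})=\{\varphi\in\mathcal{D}_q:\ \exists\,\psi\in L^2(\mathbb{R}_+)\ \text{such that}\ q_{\alpha,\beta}[\varphi,h]=(\psi,h)\ \text{for all}\ h\in\mathcal{D}_q\},\qquad H_{\alpha,\beta}\varphi=\psi.$$ Then $D(H_{\alpha,\beta})\subset H^2(\mathbb{R}_+)$.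 Moreover, every $\varphi\in D(H_{\alpha,\beta})$ has a representative in $C^1([0,\infty))$, and this representative satisfies $\varphi(0)=0$ and $\varphi'(0)=0$. -/

import Mathlib

open MeasureTheory Set
open scoped ContDiff

namespace LennardJones

/-- The complex Hilbert space `L²(ℝ₊)`. -/
abbrev L2 : Type := Lp ℂ 2 (volume.restrict (Ioi (0 : ℝ)))

/-- `g` is the weak derivative of `f` on `(0, ∞)`, where `f, g ∈ L²(ℝ₊)`. -/
def HasWeakDeriv (f g : L2) : Prop :=
  ∀ η : ℝ → ℂ, ContDiff ℝ ∞ η → HasCompactSupport η → tsupport η ⊆ Ioi (0 : ℝ) →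
    ∫ x in Ioi (0 : ℝ), f x * deriv η x = -∫ x in Ioi (0 : ℝ), g x * η x

/-- Weak derivatives are unique, so the choice made in `weakDeriv` below is harmless. -/
theorem HasWeakDeriv.unique {f g₁ g₂ : L2} (h₁ : HasWeakDeriv f g₁) (h₂ : HasWeakDeriv f g₂) :
    g₁ = g₂ := by
  have hloc : ∀ g : L2, LocallyIntegrableOn g (Ioi (0 : ℝ)) volume := fun g =>
    locallyIntegrableOn_of_locallyIntegrable_restrict
      ((Lp.memLp g).locallyIntegrable (by norm_num))
  have hint : ∀ (g : L2) (η : ℝ → ℂ), ContDiff ℝ ∞ η → HasCompactSupport η →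
      Integrable (fun x => g x * η x) (volume.restrict (Ioi (0 : ℝ))) := fun g η hη hc =>
    (Lp.memLp g).integrable_mul (q := 2)
      (hη.continuous.memLp_of_hasCompactSupport hc)
  have key : ∀ᵐ x, x ∈ Ioi (0 : ℝ) → g₁ x - g₂ x = 0 := by
    refine isOpen_Ioi.ae_eq_zero_of_integral_contDiff_smul_eq_zero
      (f := fun x => g₁ x - g₂ x) ((hloc g₁).sub (hloc g₂)) ?_
    intro η hη hc hs
    have hη' : ContDiff ℝ ∞ (fun x => (η x : ℂ)) := Complex.ofRealCLM.contDiff.comp hη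
    have hc' : HasCompactSupport (fun x => (η x : ℂ)) :=
      hc.comp_left (g := fun t : ℝ => (t : ℂ)) Complex.ofReal_zero
    have hs' : tsupport (fun x => (η x : ℂ)) ⊆ Ioi (0 : ℝ) :=
      (tsupport_comp_subset (g := fun t : ℝ => (t : ℂ)) Complex.ofReal_zero η).trans hs
    have e := (h₁ _ hη' hc' hs').symm.trans (h₂ _ hη' hc' hs')
    have e' := neg_injective e
    have hzero : ∀ x, x ∉ Ioi (0 : ℝ) → η x • (g₁ x - g₂ x) = 0 := fun x hx => by
      rw [image_eq_zero_of_notMem_tsupport (fun h => hx (hs h)), zero_smul]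
    rw [← setIntegral_eq_integral_of_forall_compl_eq_zero hzero]
    have : ∀ x, η x • (g₁ x - g₂ x) = g₁ x * (η x : ℂ) - g₂ x * (η x : ℂ) := fun x => by
      rw [Complex.real_smul]; ring
    simp_rw [this]
    rw [integral_sub (hint g₁ _ hη' hc') (hint g₂ _ hη' hc'), e', sub_self]
  refine Lp.ext ?_
  filter_upwards [(ae_restrict_iff' measurableSet_Ioi).2 key] with x hx
  exact sub_eq_zero.1 hx

/-- The Sobolev space `H¹(ℝ₊)`. -/
def H1 : Set L2 := {f | ∃ g : L2, HasWeakDeriv f g}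

/-- The Sobolev space `H²(ℝ₊)`. -/
def H2 : Set L2 := {f | ∃ g k : L2, HasWeakDeriv f g ∧ HasWeakDeriv g k}

open Classical in
/-- The weak derivative of an element of `H¹(ℝ₊)` (and `0` outside of `H¹(ℝ₊)`). -/
noncomputable def weakDeriv (f : L2) : L2 :=
  if h : ∃ g : L2, HasWeakDeriv f g then h.choose else 0

theorem HasWeakDeriv.weakDeriv_eq {f g : L2} (h : HasWeakDeriv f g) : weakDeriv f = g := by
  have hex : ∃ g : L2, HasWeakDeriv f g := ⟨g, h⟩
  rw [weakDeriv, dif_pos hex]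
  exact hex.choose_spec.unique h

/-- The potential `V(x) = α / |x|¹² - β / |x|⁶`. -/
noncomputable def V (α β : ℝ) (x : ℝ) : ℝ := α / |x| ^ 12 - β / |x| ^ 6

/-- The form domain: all `φ ∈ H¹(ℝ₊)` with `∫ V |φ|² < ∞`. As `V` is bounded from below and
`φ ∈ L²`, finiteness of this integral means integrability of `V |φ|²`. -/
def formDomain (α β : ℝ) : Set L2 :=
  {φ | φ ∈ H1 ∧ IntegrableOn (fun x => V α β x * ‖φ x‖ ^ 2) (Ioi (0 : ℝ))}

/-- The sesquilinear form `q[φ, h]`, conjugate linear in the first argument. -/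
noncomputable def form (α β : ℝ) (φ h : L2) : ℂ :=
  (∫ x in Ioi (0 : ℝ), starRingEnd ℂ (weakDeriv φ x) * weakDeriv h x)
    + α * (∫ x in Ioi (0 : ℝ), starRingEnd ℂ (φ x) * h x / (|x| ^ 12 : ℝ))
    - β * (∫ x in Ioi (0 : ℝ), starRingEnd ℂ (φ x) * h x / (|x| ^ 6 : ℝ))

/-- The graph of the self-adjoint operator `H` associated with the form `q`:
`φ ∈ D(H)` and `H φ = ψ`. -/
def IsOperatorValue (α β : ℝ) (φ ψ : L2) : Prop :=
  φ ∈ formDomain α β ∧ ∀ h ∈ formDomain α β, form α β φ h = inner ℂ ψ h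

/-- The domain `D(H)` of the operator associated with the form `q`. -/
def operatorDomain (α β : ℝ) : Set L2 := {φ | ∃ ψ : L2, IsOperatorValue α β φ ψ}

end LennardJones

namespace LennardJones

/-! The core is an a priori estimate: if `φ ∈ D(H)` then `φ / x¹²` is in `L²`, so that `Vφ` is in
`L²`. Formally one tests the weak equation with `h = x⁻¹² φ`. Since this `h` need not lie in the
form domain, `x⁻¹²` is replaced by the bounded smooth `w = (x² + ε)⁻⁶`. In the real part of the
tested identity, `α ∫ w x⁻¹² |φ|²` dominates: the cross term from `w'`, the `β` term and the `ψ`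
term each cost at most a quarter of it, plus quantities controlled by `‖φ / x⁶‖²` and `‖ψ‖²`,
uniformly in `ε` (`weighted_energy_lower_bound`, `IsOperatorValue.exists_weighted_bound`). Fatou's
lemma then gives `IsOperatorValue.memLp_div_pow_twelve`.

Testing with compactly supported functions now yields `φ'' = Vφ - ψ ∈ L²`, which is the `H²` claim.
An `L²` function is integrable up to `0`, so `φ'` and then `φ` are primitives
(`HasWeakDeriv.exists_ae_eq`) and `φ` is `C¹` on the closed half-line. If `φ(0)` or `φ'(0)` were
nonzero, `|φ|` would be at least `c x` near `0`, contradicting integrability of `|φ|² / x¹²`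
(`eq_zero_of_integrable_div_pow`). -/

/-! ### Primitives of integrable functions and integration by parts. -/

theorem absolutelyContinuousOnInterval_integral {K : ℝ → ℂ} {a b : ℝ}
    (hK : IntervalIntegrable K volume a b) :
    AbsolutelyContinuousOnInterval (fun x => ∫ t in a..x, K t) a b := by
  have hre : IntervalIntegrable (fun x => (K x).re) volume a b := ⟨hK.1.re, hK.2.re⟩
  have him : IntervalIntegrable (fun x => (K x).im) volume a b := ⟨hK.1.im, hK.2.im⟩
  have hconst : ∀ z : ℂ, AbsolutelyContinuousOnInterval (fun _ : ℝ => z) a b := fun z =>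
    contDiffOn_const.absolutelyContinuousOnInterval
  have h := ((hre.absolutelyContinuousOnInterval_intervalIntegral
    (c := a) left_mem_uIcc).fun_smul (hconst 1)).fun_add
    ((him.absolutelyContinuousOnInterval_intervalIntegral
      (c := a) left_mem_uIcc).fun_smul (hconst Complex.I))
  -- The recombined real and imaginary primitives are compared with the complex one only on `uIcc a
  -- b`, where `K` is integrable. The ε-δ form evaluates only there.
  rw [absolutelyContinuousOnInterval_iff] at h ⊢
  have heq : ∀ x ∈ uIcc a b, (∫ t in a..x, (K t).re) • (1 : ℂ) +
      (∫ t in a..x, (K t).im) • Complex.I = ∫ t in a..x, K t := by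
    intro x hx
    have hKx : IntervalIntegrable K volume a x := hK.mono_set (uIcc_subset_uIcc_left hx)
    have e1 : ((∫ t in a..x, (K t).re : ℝ) : ℂ) = ∫ t in a..x, ((K t).re : ℂ) :=
      intervalIntegral.integral_ofReal.symm
    have e2 : ((∫ t in a..x, (K t).im : ℝ) : ℂ) = ∫ t in a..x, ((K t).im : ℂ) :=
      intervalIntegral.integral_ofReal.symm
    simp only [Complex.real_smul, mul_one]
    rw [e1, e2, ← intervalIntegral.integral_mul_const, ← intervalIntegral.integral_add]
    · simp only [Complex.re_add_im]
    · exact ⟨hKx.1.re.ofReal, hKx.2.re.ofReal⟩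
    · exact IntervalIntegrable.mul_const ⟨hKx.1.im.ofReal, hKx.2.im.ofReal⟩ _
  intro ε hε
  obtain ⟨δ, hδ, h⟩ := h ε hε
  refine ⟨δ, hδ, fun E hE hlt => ?_⟩
  refine lt_of_eq_of_lt (Finset.sum_congr rfl fun i hi => ?_) (h E hE hlt)
  have := hE.1 i hi
  rw [← heq _ this.1, ← heq _ this.2]

/-- Integration by parts for an integral against a smooth function. -/
theorem integral_primitive_mul_deriv {K η : ℝ → ℂ} {a b : ℝ}
    (hK : IntervalIntegrable K volume a b) (hη : ContDiff ℝ 1 η) (ha : η b = 0) :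
    ∫ x in a..b, (∫ t in a..x, K t) * deriv η x = -∫ x in a..b, K x * η x := by
  set G : ℝ → ℂ := fun x => ∫ t in a..x, K t with hG
  have hGac := absolutelyContinuousOnInterval_integral hK
  have hηac : AbsolutelyContinuousOnInterval η a b :=
    hη.contDiffOn.absolutelyContinuousOnInterval
  have hdη : Continuous (deriv η) := hη.continuous_deriv le_rfl
  have i1 : IntervalIntegrable (fun x => K x * η x) volume a b :=
    hK.mul_continuousOn hη.continuous.continuousOn
  have i2 : IntervalIntegrable (fun x => G x * deriv η x) volume a b :=
    (hGac.continuousOn.mul hdη.continuousOn).intervalIntegrable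
  have i3 := i1.add i2
  -- `Gη - ∫ (Kη + Gη')` is absolutely continuous with derivative zero almost everywhere, hence
  -- constant. The boundary terms vanish because `G a = 0` and `η b = 0`.
  have hac := (hGac.fun_smul hηac).fun_sub (absolutelyContinuousOnInterval_integral i3)
  obtain ⟨C, hC⟩ := hac.const_of_ae_hasDerivAt_zero (by
    filter_upwards [hK.ae_hasDerivAt_integral, i3.ae_hasDerivAt_integral] with x h1 h2 hx
    have d1 := h1 hx a left_mem_uIcc
    have d2 := h2 hx a left_mem_uIcc
    have d3 : HasDerivAt η (deriv η x) x :=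
      (hη.differentiable one_ne_zero x).hasDerivAt
    have d := (d1.smul d3).sub d2
    have e0 : (∫ t in a..x, K t) • deriv η x + K x • η x - (K x * η x + G x * deriv η x) = 0 := by
      simp only [smul_eq_mul, hG]
      ring
    rw [e0] at d
    exact d)
  have hCa := hC a left_mem_uIcc
  have hCb := hC b right_mem_uIcc
  simp only [smul_eq_mul, ha, intervalIntegral.integral_same,
    mul_zero, zero_mul, sub_zero, zero_sub] at hCa hCb
  rw [← hCa, neg_eq_zero] at hCb
  rw [intervalIntegral.integral_add i1 i2] at hCb
  exact eq_neg_of_add_eq_zero_right hCb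

theorem exists_tsupport_subset_Icc {η : ℝ → ℂ} (hc : HasCompactSupport η)
    (hs : tsupport η ⊆ Ioi (0 : ℝ)) : ∃ a b : ℝ, 0 < a ∧ a < b ∧ tsupport η ⊆ Icc a b := by
  rcases (tsupport η).eq_empty_or_nonempty with he | hne
  · exact ⟨1, 2, by norm_num, by norm_num, he ▸ empty_subset _⟩
  · obtain ⟨m, hm, hmin⟩ := hc.isCompact.exists_isLeast hne
    obtain ⟨M, hM, hmax⟩ := hc.isCompact.exists_isGreatest hne
    exact ⟨m, M + 1, hs hm, by linarith [hmin hM], fun x hx => ⟨hmin hx, by linarith [hmax hx]⟩⟩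

theorem setIntegral_Ioi_eq_intervalIntegral {F : ℝ → ℂ} {b : ℝ} (hb : 0 ≤ b)
    (hF : ∀ x, b < x → F x = 0) : ∫ x in Ioi (0 : ℝ), F x = ∫ x in (0 : ℝ)..b, F x := by
  rw [intervalIntegral.integral_of_le hb]
  refine setIntegral_eq_of_subset_of_forall_sdiff_eq_zero measurableSet_Ioi
    Ioc_subset_Ioi_self ?_
  rintro x ⟨hx, hx'⟩
  exact hF x (not_le.1 fun h => hx' ⟨hx, h⟩)

theorem eq_zero_of_tsupport_subset_Icc {η : ℝ → ℂ} {a b x : ℝ} (h : tsupport η ⊆ Icc a b)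
    (hx : x ∉ Icc a b) : η x = 0 :=
  image_eq_zero_of_notMem_tsupport fun hx' => hx (h hx')

theorem deriv_eq_zero_of_tsupport_subset_Icc {η : ℝ → ℂ} {a b x : ℝ} (h : tsupport η ⊆ Icc a b)
    (hx : x ∉ Icc a b) : deriv η x = 0 :=
  eq_zero_of_tsupport_subset_Icc ((tsupport_deriv_subset).trans h) hx

theorem setIntegral_primitive_mul_deriv {K η : ℝ → ℂ} (hK : LocallyIntegrable K volume)
    (hη : ContDiff ℝ ∞ η) (hc : HasCompactSupport η) (hs : tsupport η ⊆ Ioi (0 : ℝ)) :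
    ∫ x in Ioi (0 : ℝ), (∫ t in (0 : ℝ)..x, K t) * deriv η x
      = -∫ x in Ioi (0 : ℝ), K x * η x := by
  obtain ⟨a, b, ha, hab, hsub⟩ := exists_tsupport_subset_Icc hc hs
  -- Cutting at `b + 1` puts the endpoint strictly outside `Icc a b`, where `η` is known to vanish.
  have hb : (0 : ℝ) ≤ b + 1 := by linarith
  have hnot : ∀ x, b + 1 ≤ x → x ∉ Icc a b := fun x hx h => by linarith [h.2]
  rw [setIntegral_Ioi_eq_intervalIntegral hb fun x hx => by
      rw [deriv_eq_zero_of_tsupport_subset_Icc hsub (hnot x hx.le), mul_zero],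
    setIntegral_Ioi_eq_intervalIntegral hb fun x hx => by
      rw [eq_zero_of_tsupport_subset_Icc hsub (hnot x hx.le), mul_zero]]
  exact integral_primitive_mul_deriv (hK.integrableOn_isCompact isCompact_uIcc).intervalIntegrable (hη.of_le (by simp))
    (eq_zero_of_tsupport_subset_Icc hsub (hnot _ le_rfl))

/-! ### Du Bois-Reymond's lemma and calculus of weak derivatives. -/

/-- A test function with vanishing integral is the derivative of a test function. -/
theorem exists_deriv_eq_of_integral_eq_zero {η : ℝ → ℂ} (hη : ContDiff ℝ ∞ η)
    (hc : HasCompactSupport η) (hs : tsupport η ⊆ Ioi (0 : ℝ))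
    (h0 : ∫ x in Ioi (0 : ℝ), η x = 0) :
    ∃ ζ : ℝ → ℂ, ContDiff ℝ ∞ ζ ∧ HasCompactSupport ζ ∧ tsupport ζ ⊆ Ioi (0 : ℝ) ∧
      deriv ζ = η := by
  obtain ⟨a, b, ha, hab, hsub⟩ := exists_tsupport_subset_Icc hc hs
  have hd : ∀ x, HasDerivAt (fun x => ∫ t in (0 : ℝ)..x, η t) (η x) x := fun x =>
    hη.continuous.integral_hasStrictDerivAt 0 x |>.hasDerivAt
  have hsupp : tsupport (fun x => ∫ t in (0 : ℝ)..x, η t) ⊆ Icc a b := by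
    refine closure_minimal ?_ isClosed_Icc
    intro x hx
    by_contra hx'
    apply hx
    rcases lt_or_ge x a with h | h
    · change ∫ t in (0 : ℝ)..x, η t = 0
      rw [intervalIntegral.integral_congr (g := fun _ => 0), intervalIntegral.integral_zero]
      intro t ht
      refine eq_zero_of_tsupport_subset_Icc hsub fun h' => ?_
      have : t ≤ max 0 x := ht.2
      rcases le_max_iff.1 this with h3 | h3 <;> linarith [h'.1]
    · have hbx : b < x := not_le.1 fun h' => hx' ⟨h, h'⟩
      change ∫ t in (0 : ℝ)..x, η t = 0
      rw [← setIntegral_Ioi_eq_intervalIntegral (by linarith), h0]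
      intro y hy
      exact eq_zero_of_tsupport_subset_Icc hsub fun h' => by linarith [h'.2]
  have hderiv : deriv (fun x => ∫ t in (0 : ℝ)..x, η t) = η := funext fun x => (hd x).deriv
  refine ⟨fun x => ∫ t in (0 : ℝ)..x, η t, ?_, ?_, ?_, hderiv⟩
  · rw [contDiff_infty_iff_deriv]
    exact ⟨fun x => (hd x).differentiableAt, hderiv.symm ▸ hη⟩
  · exact HasCompactSupport.of_support_subset_isCompact isCompact_Icc
      (subset_closure.trans hsupp)
  · exact hsupp.trans fun x hx => lt_of_lt_of_le ha hx.1

theorem exists_testFunction_integral_eq_one : ∃ η : ℝ → ℂ, ContDiff ℝ ∞ η ∧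
    HasCompactSupport η ∧ tsupport η ⊆ Ioi (0 : ℝ) ∧ ∫ x in Ioi (0 : ℝ), η x = 1 := by
  let B : ContDiffBump (2 : ℝ) := ⟨1 / 2, 1, by norm_num, by norm_num⟩
  have hs' : tsupport (fun x => (B.normed volume x : ℂ)) ⊆ Ioi (0 : ℝ) := by
    refine (tsupport_comp_subset (g := fun t : ℝ => (t : ℂ)) Complex.ofReal_zero _).trans ?_
    rw [B.tsupport_normed_eq, Real.closedBall_eq_Icc]
    intro x hx
    have := hx.1
    norm_num [B] at this
    exact lt_of_lt_of_le one_pos this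
  refine ⟨fun x => (B.normed volume x : ℂ), Complex.ofRealCLM.contDiff.comp B.contDiff_normed,
    B.hasCompactSupport_normed.comp_left (g := fun t : ℝ => (t : ℂ)) Complex.ofReal_zero,
    hs', ?_⟩
  rw [setIntegral_eq_integral_of_forall_compl_eq_zero fun x hx =>
    image_eq_zero_of_notMem_tsupport (fun h => hx (hs' h)), integral_complex_ofReal,
    B.integral_normed, Complex.ofReal_one]

theorem integrableOn_mul_of_locallyIntegrable {u η : ℝ → ℂ}
    (hu : LocallyIntegrable u (volume.restrict (Ioi (0 : ℝ))))
    (hη : Continuous η) (hc : HasCompactSupport η) :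
    IntegrableOn (fun x => u x * η x) (Ioi (0 : ℝ)) := by
  have := hu.integrable_smul_left_of_hasCompactSupport hη hc
  refine this.congr (Filter.Eventually.of_forall fun x => ?_)
  simp [mul_comm]

/-- The lemma of du Bois-Reymond: a function with vanishing weak derivative is constant. -/
theorem exists_ae_eq_const {u : ℝ → ℂ}
    (hu : LocallyIntegrable u (volume.restrict (Ioi (0 : ℝ))))
    (h : ∀ η : ℝ → ℂ, ContDiff ℝ ∞ η → HasCompactSupport η → tsupport η ⊆ Ioi (0 : ℝ) →
      ∫ x in Ioi (0 : ℝ), u x * deriv η x = 0) :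
    ∃ c : ℂ, u =ᵐ[volume.restrict (Ioi (0 : ℝ))] fun _ => c := by
  obtain ⟨θ, hθ, hθc, hθs, hθ1⟩ := exists_testFunction_integral_eq_one
  set c : ℂ := ∫ x in Ioi (0 : ℝ), u x * θ x with hcdef
  refine ⟨c, ?_⟩
  have key : ∀ᵐ x, x ∈ Ioi (0 : ℝ) → u x - c = 0 := by
    refine isOpen_Ioi.ae_eq_zero_of_integral_contDiff_smul_eq_zero
      (f := fun x => u x - c)
      ((locallyIntegrableOn_of_locallyIntegrable_restrict hu).sub
        ((locallyIntegrable_const c).locallyIntegrableOn _)) ?_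
    intro ρ hρ hρc hρs
    set η : ℝ → ℂ := fun x => (ρ x : ℂ) with hηdef
    have hη : ContDiff ℝ ∞ η := Complex.ofRealCLM.contDiff.comp hρ
    have hc : HasCompactSupport η :=
      hρc.comp_left (g := fun t : ℝ => (t : ℂ)) Complex.ofReal_zero
    have hs : tsupport η ⊆ Ioi (0 : ℝ) :=
      (tsupport_comp_subset (g := fun t : ℝ => (t : ℂ)) Complex.ofReal_zero ρ).trans hρs
    have iη : IntegrableOn η (Ioi 0) :=
      (hη.continuous.integrable_of_hasCompactSupport hc).integrableOn
    have iθ : IntegrableOn θ (Ioi 0) :=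
      (hθ.continuous.integrable_of_hasCompactSupport hθc).integrableOn
    set m : ℂ := ∫ x in Ioi (0 : ℝ), η x with hm
    have hmθ : HasCompactSupport fun x => m * θ x := hθc.mul_left
    -- Subtracting `m θ` makes the mean zero, so the difference is an admissible `deriv ζ`.
    obtain ⟨ζ, hζ, hζc, hζs, hζd⟩ := exists_deriv_eq_of_integral_eq_zero
      (η := fun x => η x - m * θ x) (hη.sub (contDiff_const.mul hθ)) (hc.sub hmθ)
      ((tsupport_sub _ _).trans (union_subset hs ((tsupport_mul_subset_right).trans hθs)))
      (by rw [integral_sub iη (iθ.const_mul m), integral_const_mul, hθ1, mul_one, sub_self])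
    have e := h ζ hζ hζc hζs
    rw [hζd] at e
    have iuη := integrableOn_mul_of_locallyIntegrable hu hη.continuous hc
    have iuθ := integrableOn_mul_of_locallyIntegrable hu hθ.continuous hθc
    have e2 : ∫ x in Ioi (0 : ℝ), u x * η x = m * c := by
      have : ∀ x, u x * (η x - m * θ x) = u x * η x - m * (u x * θ x) := fun x => by ring
      simp_rw [this] at e
      rw [integral_sub iuη (iuθ.const_mul m), integral_const_mul] at e
      exact sub_eq_zero.1 e
    rw [← setIntegral_eq_integral_of_forall_compl_eq_zero (s := Ioi (0 : ℝ)) fun x hx => by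
      rw [image_eq_zero_of_notMem_tsupport (fun h => hx (hρs h)), zero_smul]]
    have : ∀ x, ρ x • (u x - c) = u x * η x - c * η x := fun x => by
      rw [Complex.real_smul]; ring
    simp_rw [this]
    rw [integral_sub iuη (iη.const_mul c), integral_const_mul, e2, ← hm, mul_comm, sub_self]
  filter_upwards [(ae_restrict_iff' measurableSet_Ioi).2 key] with x hx
  exact sub_eq_zero.1 hx

theorem locallyIntegrable_L2 (g : L2) :
    LocallyIntegrable g (volume.restrict (Ioi (0 : ℝ))) :=
  (Lp.memLp g).locallyIntegrable (by norm_num)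

/-- An element of `L2` has no controlled values on the negative axis. Cutting it off there gives
primitives based at `0` that are continuous on all of `ℝ`. -/
theorem locallyIntegrable_indicator_L2 (g : L2) :
    LocallyIntegrable ((Ioi (0 : ℝ)).indicator g) volume :=
  ((memLp_indicator_iff_restrict measurableSet_Ioi).2 (Lp.memLp g)).locallyIntegrable
    (by norm_num)

/-- A function in `H¹(ℝ₊)` is a primitive of its weak derivative. -/
theorem HasWeakDeriv.exists_ae_eq {f g : L2} (h : HasWeakDeriv f g) :
    ∃ c : ℂ, f =ᵐ[volume.restrict (Ioi (0 : ℝ))]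
      fun x => c + ∫ t in (0 : ℝ)..x, (Ioi (0 : ℝ)).indicator g t := by
  set G : ℝ → ℂ := fun x => ∫ t in (0 : ℝ)..x, (Ioi (0 : ℝ)).indicator g t with hG
  have hK := locallyIntegrable_indicator_L2 g
  have hGc : Continuous G :=
    intervalIntegral.continuous_primitive (fun a b => (hK.integrableOn_isCompact isCompact_uIcc).intervalIntegrable) 0
  have hGl : LocallyIntegrable G (volume.restrict (Ioi (0 : ℝ))) :=
    hGc.locallyIntegrable
  obtain ⟨c, hc⟩ := exists_ae_eq_const (u := fun x => f x - G x)
    ((locallyIntegrable_L2 f).sub hGl) (by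
    intro η hη hc hs
    have hd : Continuous (deriv η) := hη.continuous_deriv (by simp)
    have e1 := h η hη hc hs
    have e2 := setIntegral_primitive_mul_deriv hK hη hc hs
    simp_rw [sub_mul]
    rw [integral_sub (integrableOn_mul_of_locallyIntegrable (locallyIntegrable_L2 f) hd hc.deriv)
      (integrableOn_mul_of_locallyIntegrable hGl hd hc.deriv), e1, e2, sub_eq_zero]
    congr 1
    refine setIntegral_congr_fun measurableSet_Ioi fun x hx => ?_
    simp only [indicator_of_mem hx])
  refine ⟨c, ?_⟩
  filter_upwards [hc] with x hx
  rw [← hx]; ring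

theorem exists_L2_ae_eq {F : ℝ → ℂ} (hF : MemLp F 2 (volume.restrict (Ioi (0 : ℝ)))) :
    ∃ p : L2, p =ᵐ[volume.restrict (Ioi (0 : ℝ))] F :=
  ⟨hF.toLp F, hF.coeFn_toLp⟩

/-- The product rule for the weak derivative of the product with a smooth function. -/
theorem HasWeakDeriv.mul_contDiff {f g p d : L2} (h : HasWeakDeriv f g) {w : ℝ → ℂ}
    (hw : ContDiff ℝ ∞ w) (hp : p =ᵐ[volume.restrict (Ioi (0 : ℝ))] fun x => w x * f x)
    (hd : d =ᵐ[volume.restrict (Ioi (0 : ℝ))] fun x => w x * g x + deriv w x * f x) :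
    HasWeakDeriv p d := by
  intro η hη hc hs
  have hw' : ContDiff ℝ ∞ (deriv w) := (contDiff_infty_iff_deriv.1 hw).2
  have hη' : ContDiff ℝ ∞ (deriv η) := (contDiff_infty_iff_deriv.1 hη).2
  have e := h (fun x => w x * η x) (hw.mul hη) hc.mul_left
    (tsupport_mul_subset_right.trans hs)
  have hderiv : ∀ x, deriv (fun x => w x * η x) x = w x * deriv η x + deriv w x * η x := by
    intro x
    rw [((hw.differentiable (by simp) x).hasDerivAt.fun_mul
      (hη.differentiable (by simp) x).hasDerivAt).deriv]
    ring
  have i1 : IntegrableOn (fun x => f x * (w x * deriv η x)) (Ioi 0) :=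
    integrableOn_mul_of_locallyIntegrable (locallyIntegrable_L2 f)
      (hw.mul hη').continuous hc.deriv.mul_left
  have i2 : IntegrableOn (fun x => f x * (deriv w x * η x)) (Ioi 0) :=
    integrableOn_mul_of_locallyIntegrable (locallyIntegrable_L2 f)
      (hw'.mul hη).continuous hc.mul_left
  have i3 : IntegrableOn (fun x => g x * (w x * η x)) (Ioi 0) :=
    integrableOn_mul_of_locallyIntegrable (locallyIntegrable_L2 g)
      (hw.mul hη).continuous hc.mul_left
  simp_rw [hderiv, mul_add] at e
  rw [integral_add i1 i2] at e
  have e1 : ∫ x in Ioi (0 : ℝ), p x * deriv η x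
      = ∫ x in Ioi (0 : ℝ), f x * (w x * deriv η x) := by
    refine integral_congr_ae ?_
    filter_upwards [hp] with x hx
    rw [hx]; ring
  have e2 : ∫ x in Ioi (0 : ℝ), d x * η x = (∫ x in Ioi (0 : ℝ), g x * (w x * η x))
      + ∫ x in Ioi (0 : ℝ), f x * (deriv w x * η x) := by
    rw [← integral_add i3 i2]
    refine integral_congr_ae ?_
    filter_upwards [hd] with x hx
    rw [hx]; ring
  rw [e1, e2, eq_sub_of_add_eq e]
  ring

theorem hasWeakDeriv_of_testFunction {θ : ℝ → ℂ} (hθ : ContDiff ℝ ∞ θ)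
    (hs : tsupport θ ⊆ Ioi (0 : ℝ)) {p d : L2}
    (hp : p =ᵐ[volume.restrict (Ioi (0 : ℝ))] θ)
    (hd : d =ᵐ[volume.restrict (Ioi (0 : ℝ))] deriv θ) : HasWeakDeriv p d := by
  intro η hη hηc hηs
  have hθ' : Continuous (deriv θ) := hθ.continuous_deriv (by simp)
  have h0 : θ 0 = 0 := image_eq_zero_of_notMem_tsupport fun h => lt_irrefl (0 : ℝ) (hs h)
  have e := setIntegral_primitive_mul_deriv hθ'.locallyIntegrable hη hηc hηs
  have e0 : ∀ x, ∫ t in (0 : ℝ)..x, deriv θ t = θ x := fun x => by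
    rw [intervalIntegral.integral_deriv_eq_sub (fun t _ => hθ.differentiable (by simp) t)
      (hθ'.intervalIntegrable _ _), h0, sub_zero]
  simp_rw [e0] at e
  rw [integral_congr_ae (g := fun x => θ x * deriv η x)
      (by filter_upwards [hp] with x hx; rw [hx]), e,
    integral_congr_ae (f := fun x => d x * η x) (g := fun x => deriv θ x * η x)
      (by filter_upwards [hd] with x hx; rw [hx])]

/-! ### The form domain and the weak equation. -/

section FormDomain

variable {α β : ℝ}

theorem aestronglyMeasurable_div_pow (φ : L2) (n : ℕ) :
    AEStronglyMeasurable (fun x : ℝ => φ x / ((x ^ n : ℝ) : ℂ))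
      (volume.restrict (Ioi (0 : ℝ))) := by
  simp_rw [div_eq_mul_inv]
  exact (Lp.memLp φ).1.mul (Measurable.aestronglyMeasurable (by fun_prop))

theorem V_of_pos {x : ℝ} (hx : 0 < x) : V α β x = α / x ^ 12 - β / x ^ 6 := by
  rw [V, abs_of_pos hx]

theorem norm_div_pow_sq {x : ℝ} (hx : 0 < x) (z : ℂ) (n : ℕ) :
    ‖z / ((x ^ n : ℝ) : ℂ)‖ ^ 2 = ‖z‖ ^ 2 / x ^ (2 * n) := by
  rw [norm_div, Complex.norm_real, Real.norm_of_nonneg (by positivity), div_pow, ← pow_mul,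
    mul_comm n 2]

/-- Completing the square in `x⁻⁶` bounds `x⁻¹²` by `(2/α) V + β²/α²`. Hence the two singular terms
of the form converge separately. -/
theorem memLp_div_pow_six (hα : 0 < α) {φ : L2} (h : φ ∈ formDomain α β) :
    MemLp (fun x : ℝ => φ x / ((x ^ 6 : ℝ) : ℂ)) 2 (volume.restrict (Ioi (0 : ℝ))) := by
  have hm := aestronglyMeasurable_div_pow φ 6
  rw [memLp_two_iff_integrable_sq_norm hm]
  have i1 : Integrable (fun x => ‖φ x‖ ^ 2) (volume.restrict (Ioi (0 : ℝ))) :=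
    (memLp_two_iff_integrable_sq_norm (Lp.memLp φ).1).1 (Lp.memLp φ)
  refine ((h.2.const_mul (2 / α)).add (i1.const_mul (β ^ 2 / α ^ 2))).mono'
    (hm.norm.pow 2) ?_
  filter_upwards [ae_restrict_mem measurableSet_Ioi] with x (hx : 0 < x)
  rw [Real.norm_of_nonneg (by positivity), norm_div_pow_sq hx]
  simp only [Pi.add_apply]
  rw [V_of_pos hx]
  have hkey : 1 / x ^ 12 ≤ 2 / α * (α / x ^ 12 - β / x ^ 6) + β ^ 2 / α ^ 2 := by
    have : 2 / α * (α / x ^ 12 - β / x ^ 6) + β ^ 2 / α ^ 2 - 1 / x ^ 12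
        = (1 / x ^ 6 - β / α) ^ 2 := by
      field_simp
      ring
    nlinarith [sq_nonneg (1 / x ^ 6 - β / α)]
  calc ‖φ x‖ ^ 2 / x ^ (2 * 6) = 1 / x ^ 12 * ‖φ x‖ ^ 2 := by norm_num; ring
    _ ≤ (2 / α * (α / x ^ 12 - β / x ^ 6) + β ^ 2 / α ^ 2) * ‖φ x‖ ^ 2 := by gcongr
    _ = _ := by ring

theorem mem_formDomain {φ : L2} (h1 : φ ∈ H1)
    (h : MemLp (fun x : ℝ => φ x / ((x ^ 6 : ℝ) : ℂ)) 2 (volume.restrict (Ioi (0 : ℝ)))) :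
    φ ∈ formDomain α β := by
  refine ⟨h1, ?_⟩
  have i1 := (memLp_two_iff_integrable_sq_norm h.1).1 h
  have i2 := h.norm.integrable_mul (Lp.memLp φ).norm
  refine ((i1.const_mul α).sub (i2.const_mul β)).congr ?_
  filter_upwards [ae_restrict_mem measurableSet_Ioi] with x (hx : 0 < x)
  simp only [Pi.sub_apply, Pi.mul_apply]
  rw [norm_div_pow_sq hx, V_of_pos hx, norm_div, Complex.norm_real,
    Real.norm_of_nonneg (by positivity), show 2 * 6 = 12 from rfl]
  field_simp

theorem integrable_conj_mul {F G : ℝ → ℂ} {μ : Measure ℝ} (hF : MemLp F 2 μ)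
    (hG : MemLp G 2 μ) : Integrable (fun x => starRingEnd ℂ (F x) * G x) μ :=
  hF.star.integrable_mul hG

/-- The weak form of the equation `-φ'' + V φ = ψ`, as a single integral. -/
theorem IsOperatorValue.integral_eq_zero (hα : 0 < α) {φ ψ φ' h h' : L2}
    (H : IsOperatorValue α β φ ψ) (hφ : HasWeakDeriv φ φ') (hh : HasWeakDeriv h h')
    (hh6 : MemLp (fun x : ℝ => h x / ((x ^ 6 : ℝ) : ℂ)) 2 (volume.restrict (Ioi (0 : ℝ)))) :
    IntegrableOn (fun x => starRingEnd ℂ (φ' x) * h' x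
      + (V α β x : ℂ) * (starRingEnd ℂ (φ x) * h x) - starRingEnd ℂ (ψ x) * h x) (Ioi 0) ∧
    ∫ x in Ioi (0 : ℝ), (starRingEnd ℂ (φ' x) * h' x
      + (V α β x : ℂ) * (starRingEnd ℂ (φ x) * h x) - starRingEnd ℂ (ψ x) * h x) = 0 := by
  have e := H.2 h (mem_formDomain ⟨h', hh⟩ hh6)
  rw [form, hφ.weakDeriv_eq, hh.weakDeriv_eq, L2.inner_def] at e
  have hφ6 := memLp_div_pow_six hα H.1
  have i1 := integrable_conj_mul (Lp.memLp φ') (Lp.memLp h')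
  have i4 := integrable_conj_mul (Lp.memLp ψ) (Lp.memLp h)
  have i2 : Integrable (fun x : ℝ => starRingEnd ℂ (φ x) * h x / ((|x| ^ 12 : ℝ) : ℂ))
      (volume.restrict (Ioi (0 : ℝ))) := by
    refine (integrable_conj_mul hφ6 hh6).congr ?_
    filter_upwards [ae_restrict_mem measurableSet_Ioi] with x (hx : 0 < x)
    have hx' : (x : ℂ) ≠ 0 := by exact_mod_cast hx.ne'
    rw [map_div₀, Complex.conj_ofReal, abs_of_pos hx]
    push_cast
    field_simp
  have i3 : Integrable (fun x : ℝ => starRingEnd ℂ (φ x) * h x / ((|x| ^ 6 : ℝ) : ℂ))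
      (volume.restrict (Ioi (0 : ℝ))) := by
    refine (integrable_conj_mul (Lp.memLp φ) hh6).congr ?_
    filter_upwards [ae_restrict_mem measurableSet_Ioi] with x (hx : 0 < x)
    rw [abs_of_pos hx, mul_div_assoc]
  have heq : ∀ x : ℝ, starRingEnd ℂ (φ' x) * h' x
      + (V α β x : ℂ) * (starRingEnd ℂ (φ x) * h x) - starRingEnd ℂ (ψ x) * h x
      = starRingEnd ℂ (φ' x) * h' x + (α : ℂ) * (starRingEnd ℂ (φ x) * h x / ((|x| ^ 12 : ℝ) : ℂ))
        - (β : ℂ) * (starRingEnd ℂ (φ x) * h x / ((|x| ^ 6 : ℝ) : ℂ))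
        - starRingEnd ℂ (ψ x) * h x := by
    intro x
    rw [V]
    push_cast
    ring
  simp_rw [heq]
  have j1 := i1.fun_add (i2.const_mul (α : ℂ))
  have j2 := j1.sub' (i3.const_mul (β : ℂ))
  refine ⟨j2.sub i4, ?_⟩
  rw [integral_sub j2 i4, integral_sub j1 (i3.const_mul (β : ℂ)),
    integral_add i1 (i2.const_mul (α : ℂ)), integral_const_mul, integral_const_mul, e, sub_eq_zero]
  refine integral_congr_ae (Filter.Eventually.of_forall fun x => ?_)
  simp [mul_comm]

end FormDomain

/-! ### The regularized weight. -/

section Weight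

/-- A smooth bounded approximation of `x⁻¹²`. -/
noncomputable def weight (ε x : ℝ) : ℝ := ((x ^ 2 + ε) ^ 6)⁻¹

theorem weight_pos {ε : ℝ} (hε : 0 < ε) (x : ℝ) : 0 < weight ε x := by
  unfold weight; positivity

theorem weight_le {ε : ℝ} (hε : 0 < ε) (x : ℝ) : weight ε x ≤ (ε ^ 6)⁻¹ := by
  unfold weight
  gcongr
  nlinarith [sq_nonneg x]

theorem weight_le_inv_pow {ε x : ℝ} (hε : 0 < ε) (hx : 0 < x) : weight ε x ≤ 1 / x ^ 12 := by
  unfold weight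
  rw [one_div]
  gcongr
  calc x ^ 12 = (x ^ 2) ^ 6 := by ring
    _ ≤ (x ^ 2 + ε) ^ 6 := by gcongr; linarith

theorem contDiff_weight {ε : ℝ} (hε : 0 < ε) : ContDiff ℝ ∞ (weight ε) := by
  unfold weight
  exact ContDiff.inv (by fun_prop) fun x => by positivity

theorem deriv_weight {ε : ℝ} (hε : 0 < ε) (x : ℝ) :
    deriv (weight ε) x = -(12 * x * weight ε x / (x ^ 2 + ε)) := by
  have h1 : HasDerivAt (fun x : ℝ => x ^ 2 + ε) (2 * x) x := by
    simpa using (hasDerivAt_pow 2 x).add_const ε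
  have h2 := (h1.fun_pow 6).fun_inv (by positivity)
  have h3 : HasDerivAt (weight ε) _ x := h2
  have : 0 < x ^ 2 + ε := by positivity
  rw [h3.deriv, weight]
  field_simp
  norm_num
  ring

/-- The constant 12 does not depend on `ε`; this makes the energy estimate uniform. -/
theorem abs_deriv_weight_le {ε : ℝ} (hε : 0 < ε) {x : ℝ} (hx : 0 < x) :
    |deriv (weight ε) x| ≤ 12 * weight ε x / x := by
  have hw := weight_pos hε x
  rw [deriv_weight hε, abs_neg, abs_of_nonneg (by positivity),
    div_le_div_iff₀ (by positivity) hx]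
  nlinarith [mul_pos hw hε]

/-- Used only qualitatively at fixed `ε`, to keep `w' φ` in `L²`. -/
theorem exists_abs_deriv_weight_le {ε : ℝ} (hε : 0 < ε) :
    ∃ C, ∀ x, |deriv (weight ε) x| ≤ C := by
  refine ⟨12 * (ε ^ 6)⁻¹ * (1 + 1 / ε), fun x => ?_⟩
  have hw := weight_pos hε x
  have hp : 0 < x ^ 2 + ε := by positivity
  rw [deriv_weight hε, abs_neg, abs_div, abs_of_pos hp, abs_mul, abs_of_pos hw, abs_mul,
    abs_of_pos (by norm_num : (0 : ℝ) < 12)]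
  have hx : |x| / (x ^ 2 + ε) ≤ 1 + 1 / ε := by
    rw [div_le_iff₀ hp]
    have h1 : |x| ≤ x ^ 2 + 1 := by
      rw [← sq_abs]; nlinarith [sq_nonneg (|x| - 1), abs_nonneg x]
    have h2 : (1 + 1 / ε) * (x ^ 2 + ε) = x ^ 2 + 1 + (ε + x ^ 2 / ε) := by
      field_simp; ring
    rw [h2]
    have : 0 ≤ ε + x ^ 2 / ε := by positivity
    linarith
  calc 12 * |x| * weight ε x / (x ^ 2 + ε) = 12 * weight ε x * (|x| / (x ^ 2 + ε)) := by ring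
    _ ≤ 12 * (ε ^ 6)⁻¹ * (1 + 1 / ε) := by
      gcongr
      exact weight_le hε x

end Weight

/-! ### The weighted a priori estimate. -/

variable {α β : ℝ}

/-- Pointwise estimate of the integrand tested with `h = w φ`, where `P` plays the role of `φ'`. Of
the coefficient `α`, three quarters absorb the `w'`, `β` and `ψ` terms, leaving `α / 4`. -/
theorem weighted_energy_lower_bound (hα : 0 < α) {x w w' : ℝ} (hx : 0 < x)
    (hw : 0 < w) (hwx : w ≤ 1 / x ^ 12) (hw' : |w'| ≤ 12 * w / x) (P f ψ : ℂ) :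
    α / 4 * (w / x ^ 12 * ‖f‖ ^ 2) ≤
      (starRingEnd ℂ P * (w * P + w' * f) + (V α β x : ℂ) * (starRingEnd ℂ f * (w * f))
        - starRingEnd ℂ ψ * (w * f)).re
      + (β ^ 2 / α + 36 * (1 + 144 / α)) * (‖f‖ ^ 2 / x ^ 12) + ‖ψ‖ ^ 2 / α := by
  have hre : (starRingEnd ℂ P * (w * P + w' * f) + (V α β x : ℂ) * (starRingEnd ℂ f * (w * f))
        - starRingEnd ℂ ψ * (w * f)).re
      = w * ‖P‖ ^ 2 + w' * (starRingEnd ℂ P * f).re + V α β x * w * ‖f‖ ^ 2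
        - w * (starRingEnd ℂ ψ * f).re := by
    rw [← Complex.normSq_eq_norm_sq, ← Complex.normSq_eq_norm_sq, Complex.normSq_apply,
      Complex.normSq_apply]
    simp only [Complex.add_re, Complex.sub_re, Complex.mul_re, Complex.mul_im, Complex.add_im,
      Complex.conj_re, Complex.conj_im, Complex.ofReal_re, Complex.ofReal_im]
    ring
  rw [hre, V_of_pos hx]
  set a := ‖P‖ with ha
  set b := ‖f‖ with hb
  set c := ‖ψ‖ with hc
  have ha0 : 0 ≤ a := norm_nonneg _
  have hb0 : 0 ≤ b := norm_nonneg _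
  have hc0 : 0 ≤ c := norm_nonneg _
  have n1 : |(starRingEnd ℂ P * f).re| ≤ a * b := by
    refine (Complex.abs_re_le_norm _).trans ?_
    rw [norm_mul, RCLike.norm_conj]
  have n2 : (starRingEnd ℂ ψ * f).re ≤ c * b := by
    refine (Complex.re_le_norm _).trans ?_
    rw [norm_mul, RCLike.norm_conj]
  -- The cross term is absorbed by the kinetic term `w a²`, via `(a - 6b/x)² ≥ 0`, at the cost of a
  -- Hardy-type potential `36 / x²`.
  have s1 : -(w * (a ^ 2 + 36 * (1 / x ^ 2) * b ^ 2)) ≤ w' * (starRingEnd ℂ P * f).re := by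
    have h1 : |w' * (starRingEnd ℂ P * f).re| ≤ 12 * w / x * (a * b) := by
      rw [abs_mul]
      exact mul_le_mul hw' n1 (abs_nonneg _) (by positivity)
    have h2 : 12 * w / x * (a * b) ≤ w * (a ^ 2 + 36 * (1 / x ^ 2) * b ^ 2) := by
      have : w * (a ^ 2 + 36 * (1 / x ^ 2) * b ^ 2) - 12 * w / x * (a * b)
          = w * (a - 6 * b / x) ^ 2 := by
        field_simp
        ring
      have h3 : 0 ≤ w * (a - 6 * b / x) ^ 2 := by positivity
      linarith
    linarith [neg_abs_le (w' * (starRingEnd ℂ P * f).re)]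
  set t := 1 / x ^ 6 with ht
  have ht2 : 1 / x ^ 12 = t ^ 2 := by rw [ht]; field_simp
  have s2 : w * (starRingEnd ℂ ψ * f).re ≤ c ^ 2 / α + α / 4 * (w * t ^ 2 * b ^ 2) := by
    have h1 : w * (starRingEnd ℂ ψ * f).re ≤ w * (c * b) := by gcongr
    have h2 : w * (c * b) ≤ c ^ 2 / α + α / 4 * (w * w * b ^ 2) := by
      have : c ^ 2 / α + α / 4 * (w * w * b ^ 2) - w * (c * b)
          = 1 / α * (c - α / 2 * w * b) ^ 2 := by
        field_simp
        ring
      have h3 : 0 ≤ 1 / α * (c - α / 2 * w * b) ^ 2 := by positivity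
      linarith
    have h4 : w * w * b ^ 2 ≤ w * t ^ 2 * b ^ 2 := by
      rw [← ht2]; gcongr
    have h5 : α / 4 * (w * w * b ^ 2) ≤ α / 4 * (w * t ^ 2 * b ^ 2) := by gcongr
    linarith
  have s3 : β * t ≤ α / 4 * t ^ 2 + β ^ 2 / α := by
    have : α / 4 * t ^ 2 + β ^ 2 / α - β * t = α / 4 * (t - 2 * β / α) ^ 2 := by
      field_simp
      ring
    have h3 : 0 ≤ α / 4 * (t - 2 * β / α) ^ 2 := by positivity
    linarith
  -- With `r = x⁻²` this compares `36 r` with `(α/4) r⁶`. Beyond the threshold `1 + 144/α`, `r⁵ ≥ r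
  -- ≥ 144/α` suffices, as `144 = 4 · 36`.
  have s4 : 36 * (1 / x ^ 2) ≤ α / 4 * t ^ 2 + 36 * (1 + 144 / α) := by
    set r := 1 / x ^ 2 with hr
    have hr0 : 0 < r := by positivity
    have hrt : t ^ 2 = r ^ 6 := by rw [ht, hr]; field_simp
    rw [hrt]
    rcases le_total r (1 + 144 / α) with h | h
    · have : 0 ≤ α / 4 * r ^ 6 := by positivity
      linarith
    · have h144 : 0 < 144 / α := by positivity
      have h1 : 1 ≤ r := by linarith
      have h2 : r ≤ r ^ 5 := le_self_pow₀ h1 (by norm_num)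
      have h3 : 144 / α ≤ r ^ 5 := by linarith
      rw [div_le_iff₀ hα] at h3
      have h4 : 144 * r ≤ r ^ 5 * α * r := by gcongr
      have h5 : r ^ 5 * α * r = α * r ^ 6 := by ring
      linarith
  have e1 : w / x ^ 12 * b ^ 2 = t ^ 2 * (w * b ^ 2) := by rw [← ht2]; ring
  have e2 : b ^ 2 / x ^ 12 = t ^ 2 * b ^ 2 := by rw [← ht2]; ring
  have e3 : (α / x ^ 12 - β / x ^ 6) * w * b ^ 2 = (α * t ^ 2 - β * t) * (w * b ^ 2) := by
    rw [← ht2, ht]; ring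
  rw [e1, e2, e3]
  set K := β ^ 2 / α + 36 * (1 + 144 / α) with hK
  have hK0 : 0 ≤ K := by positivity
  have hwb : 0 ≤ w * b ^ 2 := by positivity
  have s5 : (β * t + 36 * (1 / x ^ 2)) * (w * b ^ 2)
      ≤ (α / 2 * t ^ 2 + K) * (w * b ^ 2) := by
    apply mul_le_mul_of_nonneg_right _ hwb
    linarith
  have s6 : K * (w * b ^ 2) ≤ K * (t ^ 2 * b ^ 2) := by
    rw [← ht2]; gcongr
  linarith [s1, s2, s5, s6]

theorem integrable_norm_sq_div {φ : L2} {n : ℕ}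
    (h : MemLp (fun x : ℝ => φ x / ((x ^ n : ℝ) : ℂ)) 2 (volume.restrict (Ioi (0 : ℝ)))) :
    IntegrableOn (fun x : ℝ => ‖φ x‖ ^ 2 / x ^ (2 * n)) (Ioi 0) := by
  refine ((memLp_two_iff_integrable_sq_norm h.1).1 h).congr ?_
  filter_upwards [ae_restrict_mem measurableSet_Ioi] with x (hx : 0 < x)
  exact norm_div_pow_sq hx _ _

/-- The a priori estimate for the weighted norm, uniform in the regularization. -/
theorem IsOperatorValue.exists_weighted_bound (hα : 0 < α) {φ ψ : L2}
    (H : IsOperatorValue α β φ ψ) :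
    ∃ M : ℝ, ∀ ε : ℝ, 0 < ε →
      IntegrableOn (fun x : ℝ => weight ε x / x ^ 12 * ‖φ x‖ ^ 2) (Ioi 0) ∧
      ∫ x in Ioi (0 : ℝ), weight ε x / x ^ 12 * ‖φ x‖ ^ 2 ≤ M := by
  obtain ⟨φ', hφ⟩ := H.1.1
  have h6 := memLp_div_pow_six hα H.1
  have iφ : IntegrableOn (fun x : ℝ => ‖φ x‖ ^ 2 / x ^ 12) (Ioi 0) := integrable_norm_sq_div h6
  have iψ : IntegrableOn (fun x => ‖ψ x‖ ^ 2) (Ioi 0) :=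
    (memLp_two_iff_integrable_sq_norm (Lp.memLp ψ).1).1 (Lp.memLp ψ)
  set K := β ^ 2 / α + 36 * (1 + 144 / α)
  refine ⟨4 / α * (K * (∫ x in Ioi (0 : ℝ), ‖φ x‖ ^ 2 / x ^ 12)
    + (∫ x in Ioi (0 : ℝ), ‖ψ x‖ ^ 2) / α), fun ε hε => ?_⟩
  have hwc : Continuous (weight ε) := (contDiff_weight hε).continuous
  have hw'c : Continuous (deriv (weight ε)) := (contDiff_weight hε).continuous_deriv (by simp)
  have hwC : ContDiff ℝ ∞ fun x => (weight ε x : ℂ) :=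
    Complex.ofRealCLM.contDiff.comp (contDiff_weight hε)
  have hderiv : ∀ x, deriv (fun x => (weight ε x : ℂ)) x = ((deriv (weight ε) x : ℝ) : ℂ) := fun x =>
    (((contDiff_weight hε).differentiable (by simp) x).hasDerivAt.ofReal_comp).deriv
  have hnw : ∀ x, ‖(weight ε x : ℂ)‖ ≤ (ε ^ 6)⁻¹ := fun x => by
    rw [Complex.norm_real, Real.norm_of_nonneg (weight_pos hε x).le]
    exact weight_le hε x
  obtain ⟨C, hC⟩ := exists_abs_deriv_weight_le hε
  have mw : AEStronglyMeasurable (fun x => (weight ε x : ℂ)) (volume.restrict (Ioi (0 : ℝ))) :=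
    hwC.continuous.aestronglyMeasurable
  have mul_mem : ∀ F : ℝ → ℂ, MemLp F 2 (volume.restrict (Ioi (0 : ℝ))) →
      MemLp (fun x => (weight ε x : ℂ) * F x) 2 (volume.restrict (Ioi (0 : ℝ))) :=
    fun F hF => hF.of_le_mul (c := (ε ^ 6)⁻¹) (mw.mul hF.1)
      (Filter.Eventually.of_forall fun x => by
        rw [norm_mul]; gcongr; exact hnw x)
  have dmul_mem : MemLp (fun x => ((deriv (weight ε) x : ℝ) : ℂ) * φ x) 2
      (volume.restrict (Ioi (0 : ℝ))) :=
    (Lp.memLp φ).of_le_mul (c := C)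
      ((Complex.continuous_ofReal.comp hw'c).aestronglyMeasurable.mul (Lp.memLp φ).1)
      (Filter.Eventually.of_forall fun x => by
        rw [norm_mul, Complex.norm_real]; gcongr; exact hC x)
  obtain ⟨p, hp⟩ := exists_L2_ae_eq (mul_mem φ (Lp.memLp φ))
  obtain ⟨d, hd⟩ := exists_L2_ae_eq ((mul_mem φ' (Lp.memLp φ')).add dmul_mem)
  have hpd : HasWeakDeriv p d := hφ.mul_contDiff hwC hp (by
    filter_upwards [hd] with x hx
    rw [hx, hderiv]; rfl)
  -- Boundedness of the weight makes `w φ` an admissible test function.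
  have hp6 : MemLp (fun x : ℝ => p x / ((x ^ 6 : ℝ) : ℂ)) 2 (volume.restrict (Ioi (0 : ℝ))) :=
    (mul_mem _ h6).ae_eq (by
      filter_upwards [hp] with x hx
      rw [hx, mul_div_assoc])
  obtain ⟨iG, eG⟩ := H.integral_eq_zero hα hφ hpd hp6
  have iR := iG.re.add ((iφ.const_mul K).add (iψ.div_const α))
  have hpt : ∀ᵐ x ∂(volume.restrict (Ioi (0 : ℝ))),
      α / 4 * (weight ε x / x ^ 12 * ‖φ x‖ ^ 2) ≤
      (starRingEnd ℂ (φ' x) * d x + (V α β x : ℂ) * (starRingEnd ℂ (φ x) * p x)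
        - starRingEnd ℂ (ψ x) * p x).re + (K * (‖φ x‖ ^ 2 / x ^ 12) + ‖ψ x‖ ^ 2 / α) := by
    filter_upwards [ae_restrict_mem measurableSet_Ioi, hp, hd] with x (hx : 0 < x) hpx hdx
    rw [hpx, hdx, ← add_assoc]
    exact weighted_energy_lower_bound hα hx (weight_pos hε x) (weight_le_inv_pow hε hx)
      (abs_deriv_weight_le hε hx) _ _ _
  have iW : IntegrableOn (fun x : ℝ => weight ε x / x ^ 12 * ‖φ x‖ ^ 2) (Ioi 0) := by
    refine (iφ.const_mul (ε ^ 6)⁻¹).mono' ?_ ?_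
    · exact ((hwc.measurable.div (measurable_id.pow_const 12)).aestronglyMeasurable).mul
        ((Lp.memLp φ).1.norm.pow 2)
    · filter_upwards [ae_restrict_mem measurableSet_Ioi] with x (hx : 0 < x)
      have := weight_pos hε x
      rw [Real.norm_of_nonneg (by positivity)]
      calc weight ε x / x ^ 12 * ‖φ x‖ ^ 2 = weight ε x * (‖φ x‖ ^ 2 / x ^ 12) := by ring
        _ ≤ _ := by gcongr; exact weight_le hε x
  refine ⟨iW, ?_⟩
  have hle := integral_mono_ae (iW.const_mul (α / 4)) iR hpt
  have e0 : ∫ x in Ioi (0 : ℝ), (starRingEnd ℂ (φ' x) * d x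
      + (V α β x : ℂ) * (starRingEnd ℂ (φ x) * p x) - starRingEnd ℂ (ψ x) * p x).re = 0 := by
    have := integral_re iG
    rw [eG] at this
    simpa using this
  rw [integral_const_mul] at hle
  have e1 := integral_add' iG.re ((iφ.const_mul K).add (iψ.div_const α))
  rw [e1, integral_add' (iφ.const_mul K) (iψ.div_const α), integral_const_mul,
    integral_div] at hle
  have e0' : ∫ x in Ioi (0 : ℝ), RCLike.re (starRingEnd ℂ (φ' x) * d x
      + (V α β x : ℂ) * (starRingEnd ℂ (φ x) * p x) - starRingEnd ℂ (ψ x) * p x) = 0 := e0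
  rw [e0', zero_add] at hle
  rw [div_mul_eq_mul_div, le_div_iff₀ hα]
  linarith

/-- Fatou's lemma along `ε = 1/(n+1)`: the weighted integrals are uniformly bounded and their
integrands converge pointwise to `|φ|² / x²⁴`. -/
theorem IsOperatorValue.memLp_div_pow_twelve (hα : 0 < α) {φ ψ : L2}
    (H : IsOperatorValue α β φ ψ) :
    MemLp (fun x : ℝ => φ x / ((x ^ 12 : ℝ) : ℂ)) 2 (volume.restrict (Ioi (0 : ℝ))) := by
  obtain ⟨M, hM⟩ := H.exists_weighted_bound hα
  rw [memLp_two_iff_integrable_sq_norm (aestronglyMeasurable_div_pow φ 12)]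
  have hpos : ∀ n : ℕ, (0 : ℝ) < 1 / ((n : ℝ) + 1) := fun n => by positivity
  refine integrable_of_tendsto
    (G := fun (n : ℕ) x => weight (1 / ((n : ℝ) + 1)) x / x ^ 12 * ‖φ x‖ ^ 2) ?_
    (fun n => (hM _ (hpos n)).1.1) ?_
  · filter_upwards [ae_restrict_mem measurableSet_Ioi] with x (hx : 0 < x)
    rw [norm_div_pow_sq hx]
    have hc : Filter.Tendsto (fun ε : ℝ => weight ε x / x ^ 12 * ‖φ x‖ ^ 2) (nhds 0)
        (nhds (weight 0 x / x ^ 12 * ‖φ x‖ ^ 2)) := by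
      refine ContinuousAt.tendsto (f := fun ε : ℝ => weight ε x / x ^ 12 * ‖φ x‖ ^ 2) ?_
      unfold weight
      have : (x ^ 2 + 0) ^ 6 ≠ 0 := by positivity
      have hcont : ContinuousAt (fun ε : ℝ => (x ^ 2 + ε) ^ 6) 0 := by fun_prop
      exact ((hcont.inv₀ this).div_const _).mul_const _
    have he : weight 0 x / x ^ 12 * ‖φ x‖ ^ 2 = ‖φ x‖ ^ 2 / x ^ (2 * 12) := by
      unfold weight
      rw [add_zero, show 2 * 12 = 24 from rfl]
      field_simp
    rw [he] at hc
    exact hc.comp tendsto_one_div_add_atTop_nhds_zero_nat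
  · refine ne_top_of_le_ne_top (ENNReal.ofReal_ne_top (r := M)) ?_
    refine Filter.liminf_le_of_frequently_le' (Filter.Frequently.of_forall fun n => ?_)
    obtain ⟨i, hi⟩ := hM _ (hpos n)
    rw [← ofReal_integral_norm_eq_lintegral_enorm i]
    refine ENNReal.ofReal_le_ofReal (le_trans (le_of_eq ?_) hi)
    refine integral_congr_ae ?_
    filter_upwards [ae_restrict_mem measurableSet_Ioi] with x (hx : 0 < x)
    have := weight_pos (hpos n) x
    rw [Real.norm_of_nonneg (by positivity)]

/-! ### Second weak derivative and boundary values. -/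

theorem memLp_testFunction_div {η : ℝ → ℂ} (hη : Continuous η) (hc : HasCompactSupport η)
    (hs : tsupport η ⊆ Ioi (0 : ℝ)) (n : ℕ) :
    MemLp (fun x : ℝ => η x / ((x ^ n : ℝ) : ℂ)) 2 (volume.restrict (Ioi (0 : ℝ))) := by
  obtain ⟨a, b, ha, hab, hsub⟩ := exists_tsupport_subset_Icc hc hs
  have hm : MemLp η 2 (volume.restrict (Ioi (0 : ℝ))) := hη.memLp_of_hasCompactSupport hc
  refine hm.of_le_mul (c := (a ^ n)⁻¹) ?_ (Filter.Eventually.of_forall fun x => ?_)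
  · simp_rw [div_eq_mul_inv]
    exact hm.1.mul (Measurable.aestronglyMeasurable (by fun_prop))
  · by_cases hx : x ∈ Icc a b
    · have hx0 : 0 < x := ha.trans_le hx.1
      rw [norm_div, Complex.norm_real, Real.norm_of_nonneg (by positivity), div_eq_inv_mul]
      gcongr
      exact hx.1
    · rw [eq_zero_of_tsupport_subset_Icc hsub hx]
      simp

/-- On the operator domain the equation `φ'' = V φ - ψ` holds weakly in `L²(ℝ₊)`. -/
theorem IsOperatorValue.exists_second_weakDeriv (hα : 0 < α) {φ ψ φ' : L2}
    (H : IsOperatorValue α β φ ψ) (hφ : HasWeakDeriv φ φ') : ∃ k : L2, HasWeakDeriv φ' k := by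
  have h12 := H.memLp_div_pow_twelve hα
  have h6 := memLp_div_pow_six hα H.1
  have hmem : MemLp (fun x => (V α β x : ℂ) * φ x - ψ x) 2 (volume.restrict (Ioi (0 : ℝ))) := by
    refine (((h12.const_mul (α : ℂ)).sub (h6.const_mul (β : ℂ))).sub (Lp.memLp ψ)).ae_eq ?_
    filter_upwards [ae_restrict_mem measurableSet_Ioi] with x (hx : 0 < x)
    simp only [Pi.sub_apply]
    rw [V_of_pos hx]
    push_cast
    ring
  obtain ⟨k, hk⟩ := exists_L2_ae_eq hmem
  refine ⟨k, fun η hη hc hs => ?_⟩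
  have hη' : Continuous (deriv η) := hη.continuous_deriv (by simp)
  -- The form is conjugate linear in `φ`, whereas `HasWeakDeriv` is bilinear. Testing with the
  -- conjugate of `η` and conjugating the identity reconciles them.
  set θ : ℝ → ℂ := fun x => starRingEnd ℂ (η x) with hθdef
  have hθ : ContDiff ℝ ∞ θ := Complex.conjCLE.contDiff.comp hη
  have hθc : HasCompactSupport θ := hc.comp_left (g := fun z : ℂ => starRingEnd ℂ z) (map_zero _)
  have hθs : tsupport θ ⊆ Ioi (0 : ℝ) :=
    (tsupport_comp_subset (g := fun z : ℂ => starRingEnd ℂ z) (map_zero _) η).trans hs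
  have hθd : ∀ x, deriv θ x = starRingEnd ℂ (deriv η x) := fun x =>
    ((hη.differentiable (by simp) x).hasDerivAt.star).deriv
  have hθ' : Continuous (deriv θ) := hθ.continuous_deriv (by simp)
  obtain ⟨h, hh⟩ := exists_L2_ae_eq (hθ.continuous.memLp_of_hasCompactSupport
    (μ := volume.restrict (Ioi (0 : ℝ))) (p := 2) hθc)
  obtain ⟨h', hh'⟩ := exists_L2_ae_eq (hθ'.memLp_of_hasCompactSupport
    (μ := volume.restrict (Ioi (0 : ℝ))) (p := 2) hθc.deriv)
  have hh6 : MemLp (fun x : ℝ => h x / ((x ^ 6 : ℝ) : ℂ)) 2 (volume.restrict (Ioi (0 : ℝ))) :=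
    (memLp_testFunction_div hθ.continuous hθc hθs 6).ae_eq (by
      filter_upwards [hh] with x hx
      rw [hx])
  have e := (H.integral_eq_zero hα hφ (hasWeakDeriv_of_testFunction hθ hθs hh hh') hh6).2
  have e' := congrArg (starRingEnd ℂ) e
  rw [← integral_conj, map_zero] at e'
  have i1 : IntegrableOn (fun x => φ' x * deriv η x) (Ioi 0) :=
    integrableOn_mul_of_locallyIntegrable (locallyIntegrable_L2 φ') hη' hc.deriv
  have i2 : IntegrableOn (fun x => k x * η x) (Ioi 0) :=
    integrableOn_mul_of_locallyIntegrable (locallyIntegrable_L2 k) hη.continuous hc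
  have e2 : ∫ x in Ioi (0 : ℝ), (φ' x * deriv η x + k x * η x) = 0 := by
    rw [← e']
    refine integral_congr_ae ?_
    filter_upwards [hh, hh', hk] with x h1 h2 h3
    rw [h1, h2, h3, hθd]
    simp only [hθdef, map_sub, map_add, map_mul, Complex.conj_conj, Complex.conj_ofReal]
    ring
  rw [integral_add i1 i2] at e2
  exact eq_neg_of_add_eq_zero_left e2

/-- A differentiable function whose square is integrable near `0` against `x⁻¹²` vanishes at `0`
together with its derivative. -/
theorem eq_zero_of_integrable_div_pow {f : ℝ → ℂ} {f' : ℂ} (hf : HasDerivAt f f' 0)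
    (hi : IntegrableOn (fun x : ℝ => ‖f x‖ ^ 2 / x ^ 12) (Ioi 0)) : f 0 = 0 ∧ f' = 0 := by
  by_contra hne
  -- If `f 0` and `f'` are not both zero, `f` is bounded below near `0` by a multiple of `|x|`.
  have hO : (fun x : ℝ => x) =O[nhds 0] f := by
    by_cases h0 : f 0 = 0
    · have h1 : f' ≠ 0 := fun h => hne ⟨h0, h⟩
      have h2 := (HasDerivAtFilter.isTheta_sub hf h1).isBigO_symm.comp_tendsto
        (k := fun x : ℝ => (x, (0 : ℝ))) (Filter.tendsto_id.prodMk
          (Filter.tendsto_pure.2 (Filter.Eventually.of_forall fun _ => rfl)))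
      simpa [Function.comp_def, h0] using h2
    · have h1 : (fun _ : ℝ => (1 : ℝ)) =O[nhds 0] f :=
        (Asymptotics.isBigO_const_left_iff_pos_le_norm one_ne_zero).2
          ⟨‖f 0‖ / 2, by positivity,
            (hf.continuousAt.norm.eventually (lt_mem_nhds (by
              have : 0 < ‖f 0‖ := norm_pos_iff.2 h0
              linarith))).mono fun x hx => hx.le⟩
      exact ((continuousAt_id (x := (0 : ℝ))).tendsto.isBigO_one ℝ).trans h1
  have hint : IntervalIntegrable (fun x : ℝ => ‖f x‖ ^ 2 / x ^ 12) volume 0 1 :=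
    (intervalIntegrable_iff_integrableOn_Ioc_of_le zero_le_one).2
      (hi.mono_set Ioc_subset_Ioi_self)
  -- The integrand is at least of order `x⁻¹⁰`; for `|x| ≤ 1` comparison with the nonintegrable
  -- `x⁻¹` is enough.
  refine not_intervalIntegrable_of_sub_inv_isBigO_punctured ?_ zero_ne_one left_mem_uIcc hint
  obtain ⟨C, hC⟩ := hO.bound
  refine Asymptotics.IsBigO.of_bound (C ^ 2) ?_
  filter_upwards [hC.filter_mono nhdsWithin_le_nhds, self_mem_nhdsWithin,
    nhdsWithin_le_nhds (Metric.ball_mem_nhds (0 : ℝ) one_pos)] with x h1 h2 h3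
  have hx : 0 < |x| := abs_pos.2 h2
  have hx1 : |x| ≤ 1 := by simpa using (mem_ball_zero_iff.1 h3).le
  rw [sub_zero, norm_inv, norm_div, norm_pow, norm_pow, norm_norm, Real.norm_eq_abs] at *
  have h4 : |x| ^ 2 ≤ C ^ 2 * ‖f x‖ ^ 2 := by
    rw [← mul_pow]; gcongr
  rw [← mul_div_assoc, le_div_iff₀ (by positivity)]
  refine le_trans ?_ h4
  have : |x|⁻¹ * |x| ^ 12 = |x| ^ 2 * |x| ^ 9 := by field_simp
  rw [this]
  exact mul_le_of_le_one_right (by positivity) (pow_le_one₀ hx.le hx1)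

end LennardJones

/-! ### The main theorem. -/

theorem mainTheorem5 (α β : ℝ) (hα : 0 < α) (hβ : 0 < β) :
    LennardJones.operatorDomain α β ⊆ LennardJones.H2 ∧
    ∀ φ ∈ LennardJones.operatorDomain α β,
      ∃ f : ℝ → ℂ, ContDiffOn ℝ 1 f (Ici 0) ∧ φ =ᵐ[volume.restrict (Ioi (0 : ℝ))] f ∧
        f 0 = 0 ∧ HasDerivWithinAt f 0 (Ici 0) 0 := by
  open LennardJones in
  refine ⟨?_, ?_⟩
  · rintro φ ⟨ψ, H⟩
    obtain ⟨φ', hφ⟩ := H.1.1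
    obtain ⟨k, hk⟩ := H.exists_second_weakDeriv hα hφ
    exact ⟨φ', k, hφ, hk⟩
  · rintro φ ⟨ψ, H⟩
    obtain ⟨φ', hφ⟩ := H.1.1
    obtain ⟨k, hk⟩ := H.exists_second_weakDeriv hα hφ
    obtain ⟨c₀, h₀⟩ := hφ.exists_ae_eq
    obtain ⟨c₁, h₁⟩ := hk.exists_ae_eq
    -- `g` is a continuous representative of `φ'`; its primitive `f` is then a `C¹` representative
    -- of `φ`, defined on all of `ℝ`.
    set g : ℝ → ℂ := fun x => c₁ + ∫ t in (0 : ℝ)..x, (Ioi (0 : ℝ)).indicator k t with hg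
    have hgc : Continuous g := continuous_const.add
      (intervalIntegral.continuous_primitive (fun a b =>
        ((locallyIntegrable_indicator_L2 k).integrableOn_isCompact
          isCompact_uIcc).intervalIntegrable) 0)
    set f : ℝ → ℂ := fun x => c₀ + ∫ t in (0 : ℝ)..x, g t with hf
    have hd : ∀ x, HasDerivAt f (g x) x := fun x =>
      (hgc.integral_hasStrictDerivAt 0 x).hasDerivAt.const_add c₀
    have hfC : ContDiff ℝ 1 f := by
      rw [contDiff_one_iff_deriv]
      refine ⟨fun x => (hd x).differentiableAt, ?_⟩
      rwa [funext fun x => (hd x).deriv]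
    have hφf : φ =ᵐ[volume.restrict (Ioi (0 : ℝ))] f := by
      filter_upwards [h₀, ae_restrict_mem measurableSet_Ioi] with x hx (hx0 : 0 < x)
      rw [hx, hf]
      congr 1
      refine intervalIntegral.integral_congr_ae ?_
      rw [uIoc_of_le hx0.le]
      filter_upwards [(ae_restrict_iff' measurableSet_Ioi).1 h₁] with t ht htx
      have ht0 : t ∈ Ioi (0 : ℝ) := htx.1
      rw [indicator_of_mem ht0, ht ht0]
    have hi : IntegrableOn (fun x : ℝ => ‖f x‖ ^ 2 / x ^ 12) (Ioi 0) := by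
      refine Integrable.congr (integrable_norm_sq_div (memLp_div_pow_six hα H.1)) ?_
      filter_upwards [hφf] with x hx
      rw [hx]
    obtain ⟨hf0, hg0⟩ := eq_zero_of_integrable_div_pow (hd 0) hi
    exact ⟨f, hfC.contDiffOn, hφf, hf0, (hg0 ▸ hd 0).hasDerivWithinAt⟩
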